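/- Let $\Bbbk$ be a field, let $R$ be a commutative noetherian domain that is a $\Bbbk$-algebra, and let $n\ge 1$. Let $\sigma=(\sigma_1,\dots,\sigma_n)$ be commuting $\Bbbk$-algebra automorphisms of $R$, let $p=(p_{ik})\in M_n(\Bbbk^\times)$ satisfy $p_{ik}=p_{ki}^{-1}$ for all $i,k$, and let $R_p[t^{\pm1};\sigma]$ be the iterated skew Laurent extension, generated over $R$ by $t_1^{\pm1},\dots,t_n^{\pm1}$ with relations $t_i^{\pm1}r=\sigma_i^{\pm1}(r)t_i^{\pm1}$ ($r\in R$) and $t_kt_i=p_{ik}t_it_k$ for $i\ne k$. Let $H_1,\dots,H_n$ and $J_1,\dots,J_n$ be ideals of $R$ with $\sigma_i(H_k)=H_k$ and $\sigma_i(J_k)=J_k$ for all $i\ne k$. For $m\in\mathbb Z$ put $$I_i^{(m)}=\begin{cases}J_i\,\sigma_i(J_i)\cdots\sigma_i^{m-1}(J_i)& m>0,\\ R& m=0,\\ \sigma_i^{-1}(H_i)\,\sigma_i^{-2}(H_i)\cdots\sigma_i^{m}(H_i)& m<0,\end{cases}$$ and assume that $I_i^{(m)}\neq 0$ for all $i$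 and $m$. For $\alpha\in\mathbb Z^n$ put $I^{(\alpha)}=I_1^{(\alpha_1)}\cdots I_n^{(\alpha_n)}$ and $t^\alpha=t_1^{\alpha_1}\cdots t_n^{\alpha_n}$, and let $$B=\bigoplus_{\alpha\in\mathbb Z^n}I^{(\alpha)}t^\alpha\subseteq R_p[t^{\pm1};\sigma]$$ be the corresponding Bell--Rogalski (BR) algebra of rank $n$. Let $\Gamma$ be the subgroup of $\operatorname{Aut}(R)$ generated by $\sigma_1,\dots,\sigma_n$, and call $R$ $\Gamma$-simple if the only ideals $I$ of $R$ with $\tau(I)=I$ for all $\tau\in\Gamma$ are $0$ and $R$. Let $$\mathcal X=\bigl(\{a t^\alpha : \alpha\in\mathbb Z^n\setminus\{0\},\ \alpha_i\ge0\text{ for all }i,\ a\in I^{(\alpha)}\}\cup\{1\}\bigr)\setminus\{0\}.$$ Then $B$ is a simple ring if and only if the following three conditions hold: (1) $BxB=B$ for all $x\in\mathcal X$; (2) $R$ is $\Gamma$-simple; (3) the center $Z(B)$ is contained in $R=B_0$. -/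

import Mathlib

open scoped Pointwise

noncomputable section

/-- The data of an iterated skew Laurent extension of rank `n` over a commutative `𝕜`-algebra `R`:
commuting algebra automorphisms `σ i` of `R` and a multiplicatively antisymmetric matrix `p` of
nonzero scalars. -/
structure SkewLaurentDatum (𝕜 R : Type*) [Field 𝕜] [CommRing R] [Algebra 𝕜 R] (n : ℕ) where
  σ : Fin n → (R ≃ₐ[𝕜] R)
  σ_comm : ∀ i k, Commute (σ i) (σ k)
  p : Matrix (Fin n) (Fin n) 𝕜ˣ
  p_antisymm : ∀ i k, p i k = (p k i)⁻¹

namespace SkewLaurentDatum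

variable {𝕜 R : Type*} [Field 𝕜] [CommRing R] [Algebra 𝕜 R] {n : ℕ}

theorem pairwise_commute (S : SkewLaurentDatum 𝕜 R n) (α : Fin n → ℤ) :
    ((Finset.univ : Finset (Fin n)) : Set (Fin n)).Pairwise
      (Function.onFun Commute fun i => S.σ i ^ α i) :=
  fun i _ k _ _ => (S.σ_comm i k).zpow_zpow (α i) (α k)

/-- The automorphism `σ ^ α = σ₁ ^ α₁ ⋯ σₙ ^ αₙ` (the factors commute). -/
def sigmaPow (S : SkewLaurentDatum 𝕜 R n) (α : Fin n → ℤ) : R ≃ₐ[𝕜] R :=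
  Finset.univ.noncommProd (fun i => S.σ i ^ α i) (S.pairwise_commute α)

/-- The scalar `c α β` with `t ^ α * t ^ β = c α β • t ^ (α + β)`, where
`t ^ α = t₁ ^ α₁ ⋯ tₙ ^ αₙ` and `t_k t_i = p_{ik} t_i t_k`: sorting the product moves
`t_i ^ β_i` to the left past `t_k ^ α_k` for all `i < k`. -/
def cocycle (S : SkewLaurentDatum 𝕜 R n) (α β : Fin n → ℤ) : 𝕜ˣ :=
  ∏ i, ∏ k ∈ Finset.Ioi i, S.p i k ^ (β i * α k)

/-- The subgroup `Γ` of `Aut(R)` generated by `σ₁, …, σₙ`. -/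
def Gamma (S : SkewLaurentDatum 𝕜 R n) : Subgroup (R ≃ₐ[𝕜] R) :=
  Subgroup.closure (Set.range S.σ)

/-- `R` is `Γ`-simple: every ideal `I` with `τ(I) = I` for all `τ ∈ Γ` is `0` or `R`. -/
def IsGammaSimple (S : SkewLaurentDatum 𝕜 R n) : Prop :=
  ∀ I : Ideal R, (∀ τ ∈ S.Gamma, τ • I = I) → I = ⊥ ∨ I = ⊤

/-- The iterated skew Laurent extension `R_p[t^{±1}; σ]`: it is free as a left `R`-module on the
monomials `t ^ α`, `α ∈ ℤⁿ`; an element is the family of its (left) coefficients. -/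
def SkewLaurent (_ : SkewLaurentDatum 𝕜 R n) := (Fin n → ℤ) →₀ R

namespace SkewLaurent

variable {S : SkewLaurentDatum 𝕜 R n}

instance : AddCommGroup S.SkewLaurent := inferInstanceAs (AddCommGroup ((Fin n → ℤ) →₀ R))

variable (S) in
/-- The finitely supported family of coefficients of an element. -/
def toFinsupp : S.SkewLaurent ≃+ ((Fin n → ℤ) →₀ R) := AddEquiv.refl _

/-- The coefficient of `t ^ α` in `f`. -/
def coeff (f : S.SkewLaurent) (α : Fin n → ℤ) : R := toFinsupp S f α

variable (S) in
/-- The element `a t ^ α`. -/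
def monomial (α : Fin n → ℤ) (a : R) : S.SkewLaurent :=
  (toFinsupp S).symm (Finsupp.single α a)

/-- `(a t ^ α) (b t ^ β) = c α β • a σ ^ α (b) t ^ (α + β)`, extended additively. -/
instance : Mul S.SkewLaurent where
  mul f g := (toFinsupp S f).sum fun α a => (toFinsupp S g).sum fun β b =>
    monomial S (α + β) ((S.cocycle α β : 𝕜) • (a * S.sigmaPow α b))

instance : One S.SkewLaurent where
  one := monomial S 0 1

theorem one_def : (1 : S.SkewLaurent) = monomial S 0 1 := rfl

theorem mul_def (f g : S.SkewLaurent) : f * g = (toFinsupp S f).sum fun α a => (toFinsupp S g).sum fun β b =>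
    monomial S (α + β) ((S.cocycle α β : 𝕜) • (a * S.sigmaPow α b)) := rfl

@[ext] theorem ext {f g : S.SkewLaurent} (h : ∀ α, f.coeff α = g.coeff α) : f = g :=
  Finsupp.ext h

theorem coeff_add (f g : S.SkewLaurent) (α) : (f + g).coeff α = f.coeff α + g.coeff α :=
  Finsupp.add_apply f g α

theorem coeff_zero (α) : (0 : S.SkewLaurent).coeff α = 0 := rfl

theorem coeff_neg (f : S.SkewLaurent) (α) : (-f).coeff α = -f.coeff α :=
  Finsupp.neg_apply f α

open Classical in
theorem coeff_monomial (α β) (a : R) :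
    (monomial S α a).coeff β = if α = β then a else 0 :=
  Finsupp.single_apply

theorem monomial_zero (α) : monomial S α 0 = 0 := Finsupp.single_zero α

theorem monomial_add (α) (a b : R) : monomial S α (a + b) = monomial S α a + monomial S α b :=
  Finsupp.single_add α a b

theorem induction {P : S.SkewLaurent → Prop} (f : S.SkewLaurent) (h0 : P 0)
    (hadd : ∀ f g, P f → P g → P (f + g)) (hm : ∀ α a, P (monomial S α a)) : P f :=
  Finsupp.induction_linear f h0 hadd hm

theorem sigmaPow_zero : S.sigmaPow 0 = 1 := by
  unfold sigmaPow
  exact (Finset.noncommProd_eq_pow_card _ _ _ 1 (by simp)).trans (one_pow _)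

theorem sigmaPow_add (α β) : S.sigmaPow (α + β) = S.sigmaPow α * S.sigmaPow β := by
  unfold sigmaPow
  rw [← Finset.noncommProd_mul_distrib]
  · exact Finset.noncommProd_congr rfl (fun i _ => zpow_add _ _ _) _
  · exact fun i _ k _ _ => (S.σ_comm i k).zpow_zpow (β i) (α k)

theorem cocycle_add_left (α β γ) : S.cocycle (α + β) γ = S.cocycle α γ * S.cocycle β γ := by
  simp only [cocycle, ← Finset.prod_mul_distrib, Pi.add_apply, mul_add, zpow_add]

theorem cocycle_add_right (α β γ) : S.cocycle α (β + γ) = S.cocycle α β * S.cocycle α γ := by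
  simp only [cocycle, ← Finset.prod_mul_distrib, Pi.add_apply, add_mul, zpow_add]

theorem cocycle_zero_left (α) : S.cocycle 0 α = 1 := by simp [cocycle]

theorem cocycle_zero_right (α) : S.cocycle α 0 = 1 := by simp [cocycle]

theorem zero_mul' (f : S.SkewLaurent) : 0 * f = 0 := Finsupp.sum_zero_index

theorem mul_zero' (f : S.SkewLaurent) : f * 0 = 0 := by
  rw [mul_def]
  exact Finset.sum_eq_zero fun _ _ => Finsupp.sum_zero_index

theorem add_mul' (f g h : S.SkewLaurent) : (f + g) * h = f * h + g * h := by
  simp only [mul_def, map_add]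
  refine Finsupp.sum_add_index' (fun α => ?_) (fun α a b => ?_)
  · simp [monomial_zero]
  · rw [← Finsupp.sum_add]
    simp only [add_mul, smul_add, monomial_add]

theorem mul_add' (f g h : S.SkewLaurent) : f * (g + h) = f * g + f * h := by
  simp only [mul_def, map_add]
  rw [← Finsupp.sum_add]
  refine Finsupp.sum_congr fun α _ => ?_
  refine Finsupp.sum_add_index' (fun β => ?_) (fun β a b => ?_)
  · simp [monomial_zero]
  · simp only [map_add, mul_add, smul_add, monomial_add]

theorem monomial_mul_monomial (α β) (a b : R) :
    monomial S α a * monomial S β b =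
      monomial S (α + β) ((S.cocycle α β : 𝕜) • (a * S.sigmaPow α b)) := by
  rw [mul_def]
  refine (Finsupp.sum_single_index ?_).trans (Finsupp.sum_single_index ?_)
  · simp [monomial_zero]
  · simp [monomial_zero]

instance : Ring S.SkewLaurent where
  __ := (inferInstance : AddCommGroup S.SkewLaurent)
  zero_mul := zero_mul'
  mul_zero := mul_zero'
  left_distrib := mul_add'
  right_distrib := add_mul'
  one_mul f := by
    induction f using induction with
    | h0 => exact mul_zero' _
    | hadd f g hf hg => rw [mul_add', hf, hg]
    | hm α a =>
      simp [one_def, monomial_mul_monomial, sigmaPow_zero, cocycle_zero_left]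
  mul_one f := by
    induction f using induction with
    | h0 => exact zero_mul' _
    | hadd f g hf hg => rw [add_mul', hf, hg]
    | hm α a =>
      simp [one_def, monomial_mul_monomial, cocycle_zero_right]
  mul_assoc f g h := by
    induction f using induction with
    | h0 => simp only [zero_mul']
    | hadd f f' hf hf' => simp only [add_mul', hf, hf']
    | hm α a =>
    induction g using induction with
    | h0 => simp only [zero_mul', mul_zero']
    | hadd g g' hg hg' => simp only [add_mul', mul_add', hg, hg']
    | hm β b =>
    induction h using induction with
    | h0 => simp only [mul_zero']
    | hadd h h' hh hh' => simp only [mul_add', hh, hh']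
    | hm γ c =>
      simp only [monomial_mul_monomial, add_assoc, cocycle_add_left, cocycle_add_right,
        sigmaPow_add, AlgEquiv.mul_apply, map_mul, map_smul, Units.val_mul]
      congr 1
      simp only [Algebra.smul_def, map_mul]
      ring

variable (S) in
/-- The inclusion of `R`, as the elements of degree `0`. -/
def C : R →+* S.SkewLaurent where
  toFun := monomial S 0
  map_one' := rfl
  map_zero' := monomial_zero 0
  map_add' := monomial_add 0
  map_mul' a b := by simp [monomial_mul_monomial, sigmaPow_zero, cocycle_zero_left]

instance : Algebra 𝕜 S.SkewLaurent :=
  ((C S).comp (algebraMap 𝕜 R)).toAlgebra' fun c f => by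
    simp only [C, RingHom.comp_apply, RingHom.coe_mk, MonoidHom.coe_mk, OneHom.coe_mk]
    induction f using induction with
    | h0 => simp
    | hadd f g hf hg => rw [mul_add, add_mul, hf, hg]
    | hm α a =>
      simp [monomial_mul_monomial, sigmaPow_zero, cocycle_zero_left, cocycle_zero_right, mul_comm]

theorem algebraMap_def (c : 𝕜) :
    algebraMap 𝕜 S.SkewLaurent c = monomial S 0 (algebraMap 𝕜 R c) := rfl

/-! The defining relations of `R_p[t^{±1}; σ]` hold for `t_i ^ {±1} = t ^ {± e_i}`. -/

variable (S) in
/-- The generator `t_i`, a unit. -/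
def t (i : Fin n) : S.SkewLaurentˣ where
  val := monomial S (Pi.single i 1) 1
  inv := monomial S (-Pi.single i 1) 1
  val_inv := by
    have : S.cocycle (Pi.single i 1) (-Pi.single i 1) = 1 := by
      refine Finset.prod_eq_one fun j _ => Finset.prod_eq_one fun k hk => ?_
      have hk : j < k := by simpa using hk
      by_cases hj : j = i
      · subst hj; simp [hk.ne']
      · simp [hj]
    simp [monomial_mul_monomial, this, one_def]
  inv_val := by
    have : S.cocycle (-Pi.single i 1) (Pi.single i 1) = 1 := by
      refine Finset.prod_eq_one fun j _ => Finset.prod_eq_one fun k hk => ?_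
      have hk : j < k := by simpa using hk
      by_cases hj : j = i
      · subst hj; simp [hk.ne']
      · simp [hj]
    simp [monomial_mul_monomial, this, one_def]

theorem sigmaPow_single (i : Fin n) : S.sigmaPow (Pi.single i 1) = S.σ i := by
  classical
  unfold sigmaPow
  refine (Finset.mul_noncommProd_erase _ (Finset.mem_univ i) _ _).symm.trans ?_
  refine (congrArg _ (Finset.noncommProd_eq_pow_card _ _ _ 1 fun k hk => ?_)).trans ?_
  · simp [(Finset.mem_erase.1 hk).1]
  · simp

theorem t_mul_C (i : Fin n) (r : R) : (t S i : S.SkewLaurent) * C S r = C S (S.σ i r) * t S i := by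
  simp [t, C, monomial_mul_monomial, sigmaPow_zero, sigmaPow_single, cocycle_zero_left,
    cocycle_zero_right]

theorem cocycle_single (i k : Fin n) :
    S.cocycle (Pi.single k 1) (Pi.single i 1) = if i < k then S.p i k else 1 := by
  unfold cocycle
  split_ifs with h
  · rw [Finset.prod_eq_single i, Finset.prod_eq_single k]
    · simp
    · intro l _ hl; simp [hl]
    · intro hk; simp [h] at hk
    · intro l _ hl; simp [hl]
    · simp
  · refine Finset.prod_eq_one fun j _ => Finset.prod_eq_one fun l hl => ?_
    have hl : j < l := by simpa using hl
    by_cases hj : j = i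
    · have : l ≠ k := fun e => h (hj ▸ e ▸ hl)
      simp [this]
    · simp [hj]

theorem t_mul_t (i k : Fin n) (hik : i ≠ k) :
    (t S k : S.SkewLaurent) * t S i = algebraMap 𝕜 S.SkewLaurent (S.p i k) * (t S i * t S k) := by
  simp only [t, algebraMap_def, monomial_mul_monomial, cocycle_single, cocycle_zero_left,
    sigmaPow_zero, map_one, mul_one, zero_add, Units.val_one, one_smul, AlgEquiv.one_apply,
    add_comm (Pi.single k 1 : Fin n → ℤ)]
  congr 1
  rcases lt_or_gt_of_ne hik with h | h
  · simp [h, h.not_gt, Algebra.smul_def]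
  · simp [h, h.not_gt, Algebra.smul_def, ← map_mul, S.p_antisymm i k]

end SkewLaurent
end SkewLaurentDatum

section BellRogalski

variable {𝕜 R : Type*} [Field 𝕜] [CommRing R] [Algebra 𝕜 R] {n : ℕ}

/-- `I_σ^{(m)}(H, J)`: it is `J σ(J) ⋯ σ^{m-1}(J)` for `m > 0`, `R` (the empty product) for `m = 0`
and `σ^{-1}(H) σ^{-2}(H) ⋯ σ^m(H)` for `m < 0`. -/
def brIdeal (σ : R ≃ₐ[𝕜] R) (H J : Ideal R) (m : ℤ) : Ideal R :=
  if 0 ≤ m then ∏ j ∈ Finset.Ico 0 m, (σ ^ j) • J else ∏ j ∈ Finset.Ico m 0, (σ ^ j) • H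

variable (𝕜 R n) in
/-- A Bell--Rogalski datum `(R, t, σ, p, H, J)` of rank `n` over a commutative algebra `R`.
Here `τ • K` is the image `τ(K)` of an ideal `K`; the conditions `H_comm_H`, `H_comm_J` and
`J_comm_J` belong to the general definition and are automatic since `R` is commutative. -/
structure BRDatum extends SkewLaurentDatum 𝕜 R n where
  H : Fin n → Ideal R
  J : Fin n → Ideal R
  smul_H : ∀ i k, i ≠ k → σ i • H k = H k
  smul_J : ∀ i k, i ≠ k → σ i • J k = J k
  H_comm_H : ∀ i k, i ≠ k → H i * H k = H k * H i
  H_comm_J : ∀ i k, i ≠ k → H i * J k = J k * H i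
  J_comm_J : ∀ i k, i ≠ k → J i * J k = J k * J i
  brIdeal_ne_zero : ∀ i (m : ℤ), brIdeal (σ i) (H i) (J i) m ≠ ⊥

namespace BRDatum

/-- `I^{(α)} = I_1^{(α_1)} ⋯ I_n^{(α_n)}`. -/
def I (D : BRDatum 𝕜 R n) (α : Fin n → ℤ) : Ideal R :=
  ∏ i, brIdeal (D.σ i) (D.H i) (D.J i) (α i)

theorem brIdeal_eq (σ : R ≃ₐ[𝕜] R) (H J : Ideal R) (m : ℤ) : brIdeal σ H J m =
    (∏ j ∈ Finset.Ico 0 m, (σ ^ j) • J) * ∏ j ∈ Finset.Ico m 0, (σ ^ j) • H := by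
  unfold brIdeal
  split_ifs with h
  · simp [Finset.Ico_eq_empty_of_le h]
  · simp [Finset.Ico_eq_empty_of_le (not_le.1 h).le]

theorem smul_prod_Ico (σ : R ≃ₐ[𝕜] R) (K : Ideal R) (m a b : ℤ) :
    (σ ^ m) • ∏ j ∈ Finset.Ico a b, (σ ^ j) • K =
      ∏ j ∈ Finset.Ico (m + a) (m + b), (σ ^ j) • K := by
  rw [Finset.smul_prod']
  simp only [smul_smul, ← zpow_add]
  rw [← Finset.image_add_left_Ico, Finset.prod_image (by simp)]

theorem prod_Ico_mul_le (f : ℤ → Ideal R) (a b c : ℤ) :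
    (∏ j ∈ Finset.Ico a b, f j) * ∏ j ∈ Finset.Ico b c, f j ≤ ∏ j ∈ Finset.Ico a c, f j := by
  rw [← Finset.prod_union (Finset.Ico_disjoint_Ico_consecutive a b c),
    ← Finset.prod_sdiff (s₁ := Finset.Ico a c) (s₂ := Finset.Ico a b ∪ Finset.Ico b c)]
  · exact Ideal.mul_le_right
  · intro x hx
    simp only [Finset.mem_union, Finset.mem_Ico] at *
    omega

theorem brIdeal_mul_le (σ : R ≃ₐ[𝕜] R) (H J : Ideal R) (m l : ℤ) :
    brIdeal σ H J m * (σ ^ m) • brIdeal σ H J l ≤ brIdeal σ H J (m + l) := by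
  simp only [brIdeal_eq, smul_mul', smul_prod_Ico, add_zero]
  rw [mul_mul_mul_comm, mul_comm (∏ j ∈ Finset.Ico m 0, _)]
  exact Ideal.mul_mono (prod_Ico_mul_le _ _ _ _) (prod_Ico_mul_le _ _ _ _)

theorem smul_brIdeal_of_ne (D : BRDatum 𝕜 R n) {i k : Fin n} (h : i ≠ k) (m : ℤ) :
    D.σ i • brIdeal (D.σ k) (D.H k) (D.J k) m = brIdeal (D.σ k) (D.H k) (D.J k) m := by
  have key : ∀ j : ℤ, D.σ i * D.σ k ^ j = D.σ k ^ j * D.σ i :=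
    fun j => (D.σ_comm i k).zpow_right j
  simp only [brIdeal_eq, smul_mul', Finset.smul_prod', smul_smul, key]
  simp only [mul_smul, D.smul_H i k h, D.smul_J i k h]

theorem sigmaPow_smul_brIdeal (D : BRDatum 𝕜 R n) (α : Fin n → ℤ) (k : Fin n) (m : ℤ) :
    D.sigmaPow α • brIdeal (D.σ k) (D.H k) (D.J k) m =
      (D.σ k ^ α k) • brIdeal (D.σ k) (D.H k) (D.J k) m := by
  classical
  unfold SkewLaurentDatum.sigmaPow
  rw [← Finset.mul_noncommProd_erase _ (Finset.mem_univ k), mul_smul]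
  congr 1
  refine MulAction.mem_stabilizer_iff.1 (Subgroup.noncommProd_mem _ _ fun i hi => ?_)
  exact Subgroup.zpow_mem _ (MulAction.mem_stabilizer_iff.2
    (D.smul_brIdeal_of_ne (Finset.ne_of_mem_erase hi) m)) _

theorem I_mul_le (D : BRDatum 𝕜 R n) (α β : Fin n → ℤ) :
    D.I α * D.sigmaPow α • D.I β ≤ D.I (α + β) := by
  simp only [I, Finset.smul_prod', sigmaPow_smul_brIdeal, ← Finset.prod_mul_distrib]
  exact Finset.prod_le_prod' fun i _ => brIdeal_mul_le _ _ _ _ _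

theorem I_zero (D : BRDatum 𝕜 R n) : D.I 0 = ⊤ := by
  simp [I, brIdeal]

open SkewLaurentDatum SkewLaurent

/-- The Bell--Rogalski algebra `⨁_α I^{(α)} t^α` inside the iterated skew Laurent extension. -/
def algebra (D : BRDatum 𝕜 R n) : Subalgebra 𝕜 D.SkewLaurent where
  carrier := {f | ∀ α, f.coeff α ∈ D.I α}
  add_mem' {f g} hf hg α := by
    rw [coeff_add]
    exact Ideal.add_mem _ (hf α) (hg α)
  mul_mem' {f g} hf hg γ := by
    classical
    have hsum : ∀ (s : Finset (Fin n → ℤ)) (F : (Fin n → ℤ) → D.SkewLaurent),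
        (∀ α ∈ s, (F α).coeff γ ∈ D.I γ) → (∑ α ∈ s, F α).coeff γ ∈ D.I γ := by
      intro s F h
      refine Finset.sum_induction F (fun x => x.coeff γ ∈ D.I γ) ?_ ?_ h
      · intro x y hx hy
        rw [coeff_add]
        exact Ideal.add_mem _ hx hy
      · exact Ideal.zero_mem _
    rw [mul_def]
    refine hsum _ _ fun α _ => hsum _ _ fun β _ => ?_
    rw [coeff_monomial]
    split_ifs with h
    · subst h
      rw [Algebra.smul_def]
      refine Ideal.mul_mem_left _ _ (D.I_mul_le α β (Ideal.mul_mem_mul (hf α) ?_))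
      exact Ideal.smul_mem_pointwise_smul (D.sigmaPow α) _ _ (hg β)
    · exact Ideal.zero_mem _
  algebraMap_mem' c α := by
    classical
    rw [algebraMap_def, coeff_monomial]
    split_ifs with h
    · subst h
      rw [I_zero]
      trivial
    · exact Ideal.zero_mem _

/-- The inclusion of `R` into the Bell--Rogalski algebra, as the component of degree `0`. -/
def ofR (D : BRDatum 𝕜 R n) : R →+* D.algebra :=
  (C D.toSkewLaurentDatum).codRestrict D.algebra fun r α => by
    classical
    change (monomial _ _ _).coeff _ ∈ _
    rw [coeff_monomial]
    split_ifs with h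
    · subst h
      rw [I_zero]
      trivial
    · exact Ideal.zero_mem _

/-- The set `𝒳`, `({a t^α : a ∈ I^{(α)}, α > 0} ∪ {1}) \ {0}`, where `α > 0` means that
`α_i ≥ 0` for all `i` and `α ≠ 0`. -/
def oreSet (D : BRDatum 𝕜 R n) : Set D.algebra :=
  ({x | ∃ α : Fin n → ℤ, (∀ i, 0 ≤ α i) ∧ α ≠ 0 ∧
      ∃ a ∈ D.I α, (x : D.SkewLaurent) = monomial _ α a} ∪ {1}) \ {0}

end BRDatum

end BellRogalski

end

/-!
Write `x = a t ^ α` for the homogeneous elements of the Bell--Rogalski algebra `B`.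

If `B` is simple, then a `Γ`-invariant ideal `I` of `R` yields the two-sided ideal of elements of
`B` with all coefficients in `I` (`coeffIdeal`), so `I` is `0` or `R`. The homogeneous components
of a central element are central (`homog_coeff_mem_center`). If a nonzero central `x` had nonzero
degree, then `1 + x` would be a nonzero element of the centre, which is a field, but `1 + x` has no
inverse with finite support (`mul_one_add_monomial_ne_one`).

Conversely, let `K` be a nonzero two-sided ideal of `B`, and let `f ∈ K` be nonzero with as few
terms as possible. After multiplication by a homogeneous element the constant coefficient `a` of
`f` is nonzero. For homogeneous `b t ^ β` the element `a (b t ^ β) f - σ ^ β (a) f (b t ^ β)` of `K`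
has fewer terms than `f`, so it vanishes: over the fraction field of `R` this says that `a⁻¹ f` is
central. Therefore the denominators `{g ∈ B : a⁻¹ f g ∈ B}` form a two-sided ideal
(`denominatorIdeal`). It contains `(b t ^ β) a`, which can be chosen in `oreSet`, and every
element of `oreSet` generates `B`, so it contains `1`. Hence `f = a h` with `h` in the centre of
`B`, so `h ∈ R`, and `K` contains the nonzero element `f` of `R`. Multiplying by a homogeneous
element of positive degree gives an element of `oreSet` in `K`, and therefore `K = B`.

`Γ`-simplicity of `R` is thus a consequence of the other two conditions.
-/

namespace SkewLaurentDatum.SkewLaurent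

variable {𝕜 R : Type*} [Field 𝕜] [CommRing R] [Algebra 𝕜 R] {n : ℕ}
  {S : SkewLaurentDatum 𝕜 R n}

/-! ### Coefficients of products in the skew Laurent extension -/

theorem coeff_mul_monomial (f : S.SkewLaurent) (β : Fin n → ℤ) (b : R) (γ : Fin n → ℤ) :
    (f * monomial S β b).coeff γ =
      (S.cocycle (γ - β) β : 𝕜) • (f.coeff (γ - β) * S.sigmaPow (γ - β) b) := by
  induction f using induction with
  | h0 => simp [coeff_zero]
  | hadd f g hf hg => rw [add_mul, coeff_add, hf, hg, coeff_add, add_mul, smul_add]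
  | hm α a =>
    rw [monomial_mul_monomial, coeff_monomial, coeff_monomial]
    by_cases h : α + β = γ
    · subst h; simp
    · rw [if_neg h, if_neg (fun e => h (by rw [e]; abel))]; simp

theorem coeff_monomial_mul (f : S.SkewLaurent) (β : Fin n → ℤ) (b : R) (γ : Fin n → ℤ) :
    (monomial S β b * f).coeff γ =
      (S.cocycle β (γ - β) : 𝕜) • (b * S.sigmaPow β (f.coeff (γ - β))) := by
  induction f using induction with
  | h0 => simp [coeff_zero]
  | hadd f g hf hg => rw [mul_add, coeff_add, hf, hg, coeff_add, map_add, mul_add, smul_add]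
  | hm α a =>
    rw [monomial_mul_monomial, coeff_monomial, coeff_monomial]
    by_cases h : β + α = γ
    · subst h; simp
    · rw [if_neg h, if_neg (fun e => h (by rw [e]; abel))]; simp

theorem coeff_C_mul (f : S.SkewLaurent) (r : R) (γ : Fin n → ℤ) :
    (C S r * f).coeff γ = r * f.coeff γ := by
  change (monomial S 0 r * f).coeff γ = _
  rw [coeff_monomial_mul]
  simp [sigmaPow_zero, cocycle_zero_left]

theorem coeff_sub (f g : S.SkewLaurent) (γ : Fin n → ℤ) :
    (f - g).coeff γ = f.coeff γ - g.coeff γ :=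
  Finsupp.sub_apply f g γ

theorem C_mul_cancel [IsDomain R] {r : R} (hr : r ≠ 0) {f g : S.SkewLaurent}
    (h : C S r * f = C S r * g) : f = g := by
  ext γ
  have := congrArg (fun x => coeff x γ) h
  simp only [coeff_C_mul] at this
  exact mul_left_cancel₀ hr this

theorem monomial_mul_C (α : Fin n → ℤ) (a r : R) :
    monomial S α a * C S r = C S (S.sigmaPow α r) * monomial S α a := by
  simp [C, monomial_mul_monomial, sigmaPow_zero, cocycle_zero_left, cocycle_zero_right, mul_comm]

theorem sigmaPow_mem_Gamma (α : Fin n → ℤ) : S.sigmaPow α ∈ S.Gamma :=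
  Subgroup.noncommProd_mem _ _ fun i _ =>
    Subgroup.zpow_mem _ (Subgroup.subset_closure (Set.mem_range_self i)) _

/-! ### Supports -/

variable (S) in
/-- The set of exponents of the monomials occurring in `f`. -/
noncomputable def support (f : S.SkewLaurent) : Finset (Fin n → ℤ) := (toFinsupp S f).support

theorem mem_support {f : S.SkewLaurent} {α : Fin n → ℤ} : α ∈ support S f ↔ f.coeff α ≠ 0 :=
  Finsupp.mem_support_iff

theorem exists_coeff_ne_zero {f : S.SkewLaurent} (hf : f ≠ 0) : ∃ α, f.coeff α ≠ 0 := by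
  by_contra! h
  exact hf (ext h)

theorem sum_monomial_coeff (f : S.SkewLaurent) :
    ∑ α ∈ support S f, monomial S α (f.coeff α) = f :=
  Finsupp.sum_single f

/-- Along a ray, some coefficient vanishes. -/
theorem exists_coeff_add_nsmul_eq_zero (f : S.SkewLaurent) (β : Fin n → ℤ) {δ : Fin n → ℤ}
    (hδ : δ ≠ 0) : ∃ k : ℕ, f.coeff (β + k • δ) = 0 := by
  by_contra! h
  refine not_injective_infinite_finite
    (fun k : ℕ => (⟨β + k • δ, mem_support.2 (h k)⟩ : support S f)) fun k l hkl => ?_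
  have : k • δ = l • δ := add_left_cancel (Subtype.ext_iff.1 hkl)
  obtain ⟨i, hi⟩ := Function.ne_iff.1 hδ
  have := congrFun this i
  simp only [Pi.smul_apply, nsmul_eq_mul] at this
  exact Nat.cast_injective (mul_right_cancel₀ hi this)

/-- An inverse of `1 + a t ^ α` would have nonzero coefficients along a whole ray: either in all
degrees `k α` with `k ≥ 0`, or in all degrees `k α` with `k < 0`. -/
theorem mul_one_add_monomial_ne_one [IsDomain R] (y : S.SkewLaurent) {α : Fin n → ℤ} (hα : α ≠ 0)
    {a : R} (ha : a ≠ 0) : y * (1 + monomial S α a) ≠ 1 := by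
  intro h
  have key : ∀ γ, y.coeff γ +
      (S.cocycle (γ - α) α : 𝕜) • (y.coeff (γ - α) * S.sigmaPow (γ - α) a) =
        (1 : S.SkewLaurent).coeff γ := fun γ => by
    rw [← coeff_mul_monomial, ← coeff_add, ← h, mul_add, mul_one]
  have one_coeff : ∀ γ : Fin n → ℤ, γ ≠ 0 → (1 : S.SkewLaurent).coeff γ = 0 := fun γ hγ => by
    rw [one_def, coeff_monomial, if_neg hγ.symm]
  have hσ : ∀ γ, S.sigmaPow γ a ≠ 0 := fun γ => by simpa using ha
  -- Away from degree `0`, the coefficients at `γ` and `γ - α` vanish simultaneously.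
  have step : ∀ γ, γ ≠ 0 → (y.coeff γ ≠ 0 ↔ y.coeff (γ - α) ≠ 0) := fun γ hγ => by
    have hk := key γ
    rw [one_coeff γ hγ] at hk
    refine not_congr ⟨fun h0 => ?_, fun h0 => ?_⟩
    · rw [h0, zero_add, ← Units.smul_def, smul_eq_zero_iff_eq] at hk
      exact (mul_eq_zero.1 hk).resolve_right (hσ _)
    · simpa [h0] using hk
  have kα : ∀ k : ℕ, ((k : ℤ) + 1) • α ≠ 0 := fun k =>
    smul_ne_zero (by omega) hα
  by_cases h1 : y.coeff (-α) = 0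
  · have h0 : y.coeff 0 ≠ 0 := by
      have hk := key 0
      rw [zero_sub, h1] at hk
      have : y.coeff 0 = 1 := by simpa [one_def, coeff_monomial] using hk
      simp [this]
    obtain ⟨k, hk⟩ := exists_coeff_add_nsmul_eq_zero y 0 hα
    refine absurd hk ?_
    clear hk
    induction k with
    | zero => simpa using h0
    | succ k ih =>
      refine (step _ ?_).2 ?_
      · have := kα k
        rwa [zero_add, ← natCast_zsmul, Nat.cast_succ]
      · rwa [succ_nsmul, ← add_assoc, add_sub_cancel_right]
  · obtain ⟨k, hk⟩ := exists_coeff_add_nsmul_eq_zero y (-α) (neg_ne_zero.2 hα)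
    refine absurd hk ?_
    clear hk
    induction k with
    | zero => simpa using h1
    | succ k ih =>
      have := (step (-α + k • -α) ?_).1 ih
      · rwa [succ_nsmul, ← add_assoc, ← sub_eq_add_neg]
      · have e : -α + k • -α = -(((k : ℤ) + 1) • α) := by
          rw [add_smul, one_smul, natCast_zsmul, smul_neg]; abel
        rw [e]
        exact neg_ne_zero.2 (kα k)

end SkewLaurentDatum.SkewLaurent

namespace BRDatum

open SkewLaurentDatum SkewLaurent

variable {𝕜 R : Type*} [Field 𝕜] [CommRing R] [Algebra 𝕜 R] {n : ℕ}

/-! ### Homogeneous elements of a Bell--Rogalski algebra -/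

/-- The homogeneous element `a t ^ α` of the Bell--Rogalski algebra. -/
noncomputable def homog (D : BRDatum 𝕜 R n) (α : Fin n → ℤ) (a : R) (ha : a ∈ D.I α) : D.algebra :=
  ⟨monomial _ α a, fun γ => by
    classical
    rw [coeff_monomial]
    split_ifs with h
    · exact h ▸ ha
    · exact Ideal.zero_mem _⟩

theorem coe_homog (D : BRDatum 𝕜 R n) (α : Fin n → ℤ) (a : R) (ha : a ∈ D.I α) :
    (D.homog α a ha : D.SkewLaurent) = monomial _ α a := rfl

theorem coe_ofR (D : BRDatum 𝕜 R n) (r : R) : (D.ofR r : D.SkewLaurent) = C _ r := rfl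

theorem homog_induction {D : BRDatum 𝕜 R n} {P : D.algebra → Prop} (f : D.algebra) (h0 : P 0)
    (hadd : ∀ f g, P f → P g → P (f + g)) (hm : ∀ α a ha, P (D.homog α a ha)) : P f := by
  have : f = ∑ α ∈ support _ (f : D.SkewLaurent),
      D.homog α ((f : D.SkewLaurent).coeff α) (f.2 α) := by
    apply Subtype.ext
    rw [AddSubmonoidClass.coe_finsetSum]
    exact (sum_monomial_coeff _).symm
  rw [this]
  exact Finset.sum_induction _ P hadd h0 fun α _ => hm _ _ _

theorem exists_mem_I_ne_zero [IsDomain R] (D : BRDatum 𝕜 R n) (α : Fin n → ℤ) :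
    ∃ a ∈ D.I α, a ≠ 0 :=
  Submodule.exists_mem_ne_zero_of_ne_bot
    (Finset.prod_ne_zero_iff.2 fun i _ => D.brIdeal_ne_zero i (α i))

theorem ofR_mul_cancel [IsDomain R] (D : BRDatum 𝕜 R n) {r : R} (hr : r ≠ 0) {f g : D.algebra}
    (h : D.ofR r * f = D.ofR r * g) : f = g :=
  Subtype.ext (C_mul_cancel hr (congrArg Subtype.val h))

theorem homog_mul_ofR (D : BRDatum 𝕜 R n) (α : Fin n → ℤ) (a : R) (ha : a ∈ D.I α) (r : R) :
    D.homog α a ha * D.ofR r = D.ofR (D.sigmaPow α r) * D.homog α a ha :=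
  Subtype.ext (monomial_mul_C α a r)

theorem ofR_mul_ofR_comm (D : BRDatum 𝕜 R n) (r s : R) (f : D.algebra) :
    D.ofR r * (D.ofR s * f) = D.ofR s * (D.ofR r * f) := by
  rw [← mul_assoc, ← map_mul, mul_comm r, map_mul, mul_assoc]

/-! ### Consequences of simplicity -/

/-- The elements of the Bell--Rogalski algebra whose coefficients lie in a `Γ`-invariant ideal. -/
noncomputable def coeffIdeal (D : BRDatum 𝕜 R n) (I : Ideal R) (hI : ∀ τ ∈ D.Gamma, τ • I = I) :
    TwoSidedIdeal D.algebra :=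
  .mk' {f | ∀ α, (f : D.SkewLaurent).coeff α ∈ I} (fun _ => I.zero_mem)
    (fun {f g} hf hg α => (coeff_add (f : D.SkewLaurent) g α) ▸ I.add_mem (hf α) (hg α))
    (fun {f} hf α => (coeff_neg (f : D.SkewLaurent) α) ▸ I.neg_mem (hf α))
    (fun {x f} hf => by
      induction x using homog_induction with
      | h0 => intro α; simp [coeff_zero]
      | hadd x y hx hy =>
        intro α
        rw [add_mul, Subalgebra.coe_add, coeff_add]
        exact I.add_mem (hx α) (hy α)
      | hm β b hb =>
        intro α
        rw [Subalgebra.coe_mul, coe_homog, coeff_monomial_mul, Algebra.smul_def]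
        refine I.mul_mem_left _ (I.mul_mem_left _ ?_)
        rw [← hI _ (sigmaPow_mem_Gamma β)]
        exact Ideal.smul_mem_pointwise_smul _ _ _ (hf _))
    (fun {f x} hf => by
      induction x using homog_induction with
      | h0 => intro α; simp [coeff_zero]
      | hadd x y hx hy =>
        intro α
        rw [mul_add, Subalgebra.coe_add, coeff_add]
        exact I.add_mem (hx α) (hy α)
      | hm β b hb =>
        intro α
        rw [Subalgebra.coe_mul, coe_homog, coeff_mul_monomial, Algebra.smul_def]
        exact I.mul_mem_left _ (I.mul_mem_right _ (hf _)))

theorem mem_coeffIdeal {D : BRDatum 𝕜 R n} {I : Ideal R} {hI : ∀ τ ∈ D.Gamma, τ • I = I}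
    {f : D.algebra} : f ∈ D.coeffIdeal I hI ↔ ∀ α, (f : D.SkewLaurent).coeff α ∈ I :=
  TwoSidedIdeal.mem_mk' _ _ _ _ _ _ _

theorem isGammaSimple_of_isSimpleRing (D : BRDatum 𝕜 R n) [IsSimpleRing D.algebra] :
    D.IsGammaSimple := by
  intro I hI
  rcases eq_bot_or_eq_top (D.coeffIdeal I hI) with h | h
  · left
    refine (Submodule.eq_bot_iff _).2 fun r hr => ?_
    have hm : D.ofR r ∈ D.coeffIdeal I hI := mem_coeffIdeal.2 fun α => by
      classical
      change (monomial _ _ _).coeff _ ∈ _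
      rw [coeff_monomial]
      split_ifs
      exacts [hr, I.zero_mem]
    rw [h, TwoSidedIdeal.mem_bot] at hm
    have := congrArg (fun x : D.algebra => (x : D.SkewLaurent).coeff 0) hm
    simpa [coe_ofR, C, coeff_monomial, coeff_zero] using this
  · right
    have hm : (1 : D.algebra) ∈ D.coeffIdeal I hI := h ▸ trivial
    have := mem_coeffIdeal.1 hm 0
    rw [Ideal.eq_top_iff_one]
    simpa [one_def, coeff_monomial] using this

theorem mem_center_of_commute_homog {D : BRDatum 𝕜 R n} {x : D.algebra}
    (h : ∀ β b hb, D.homog β b hb * x = x * D.homog β b hb) :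
    x ∈ Subalgebra.center 𝕜 D.algebra := by
  refine Subalgebra.mem_center_iff.2 fun y => ?_
  induction y using homog_induction with
  | h0 => simp
  | hadd y z hy hz => rw [add_mul, mul_add, hy, hz]
  | hm β b hb => exact h β b hb

theorem homog_coeff_mem_center {D : BRDatum 𝕜 R n} {z : D.algebra}
    (hz : z ∈ Subalgebra.center 𝕜 D.algebra) (α : Fin n → ℤ) :
    D.homog α ((z : D.SkewLaurent).coeff α) (z.2 α) ∈ Subalgebra.center 𝕜 D.algebra := by
  classical
  refine mem_center_of_commute_homog fun β b hb => Subtype.ext (SkewLaurent.ext fun γ => ?_)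
  have := congrArg (fun x : D.algebra => (x : D.SkewLaurent).coeff γ)
    (Subalgebra.mem_center_iff.1 hz (D.homog β b hb))
  simp only [Subalgebra.coe_mul, coe_homog, coeff_monomial_mul,
    coeff_mul_monomial (z : D.SkewLaurent)] at this
  rw [Subalgebra.coe_mul, Subalgebra.coe_mul, coe_homog, coe_homog, coeff_monomial_mul,
    coeff_mul_monomial, coeff_monomial]
  split_ifs with h
  · rw [h, this]
  · simp

theorem center_subset_of_isSimpleRing [IsDomain R] (D : BRDatum 𝕜 R n) [IsSimpleRing D.algebra] :
    (Subalgebra.center 𝕜 D.algebra : Set D.algebra) ⊆ Set.range D.ofR := by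
  classical
  intro z hz
  refine ⟨(z : D.SkewLaurent).coeff 0, Subtype.ext (SkewLaurent.ext fun α => ?_)⟩
  change (monomial _ _ _).coeff _ = _
  rw [coeff_monomial]
  split_ifs with h
  · rw [h]
  by_contra hne
  have hx := homog_coeff_mem_center hz α
  set x := D.homog α ((z : D.SkewLaurent).coeff α) (z.2 α) with hxdef
  have h1x : 1 + x ∈ Subring.center D.algebra :=
    add_mem (one_mem (Subring.center D.algebra)) hx
  have hne0 : (⟨1 + x, h1x⟩ : Subring.center D.algebra) ≠ 0 := by
    intro e
    have := congrArg
      (fun y : Subring.center D.algebra => ((y : D.algebra) : D.SkewLaurent).coeff 0) e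
    simp [coeff_add, hxdef, coe_homog, coeff_monomial, one_def, Ne.symm h, coeff_zero] at this
  obtain ⟨y, hy⟩ := (IsSimpleRing.isField_center D.algebra).mul_inv_cancel hne0
  rw [mul_comm] at hy
  refine mul_one_add_monomial_ne_one ((y : D.algebra) : D.SkewLaurent) (Ne.symm h) (Ne.symm hne) ?_
  exact congrArg (fun y : Subring.center D.algebra => ((y : D.algebra) : D.SkewLaurent)) hy

/-! ### The simplicity criterion -/

/-- For `f` such that `a⁻¹ f` is central over the fraction field of `R`, the two-sided ideal of
those `g` with `a⁻¹ f g` in the Bell--Rogalski algebra. -/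
noncomputable def denominatorIdeal [IsDomain R] (D : BRDatum 𝕜 R n) (f : D.algebra) (a : R) (ha : a ≠ 0)
    (hf : ∀ β b hb, D.ofR a * (D.homog β b hb * f) =
      D.ofR (D.sigmaPow β a) * (f * D.homog β b hb)) : TwoSidedIdeal D.algebra :=
  .mk' {g | ∃ h, f * g = D.ofR a * h} ⟨0, by simp⟩
    (fun {g g'} ⟨h, hh⟩ ⟨h', hh'⟩ => ⟨h + h', by rw [mul_add, mul_add, hh, hh']⟩)
    (fun {g} ⟨h, hh⟩ => ⟨-h, by rw [mul_neg, mul_neg, hh]⟩)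
    (fun {x g} ⟨h, hh⟩ => ⟨x * h, by
      induction x using homog_induction with
      | h0 => simp
      | hadd x y hx hy => rw [add_mul, add_mul, mul_add, mul_add, hx, hy]
      | hm β b hb =>
        refine D.ofR_mul_cancel (r := D.sigmaPow β a) (by simpa using ha) ?_
        calc D.ofR (D.sigmaPow β a) * (f * (D.homog β b hb * g))
            = D.ofR (D.sigmaPow β a) * (f * D.homog β b hb) * g := by simp only [mul_assoc]
          _ = D.ofR a * (D.homog β b hb * (f * g)) := by rw [← hf]; simp only [mul_assoc]
          _ = D.ofR a * (D.homog β b hb * D.ofR a * h) := by rw [hh, mul_assoc]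
          _ = D.ofR (D.sigmaPow β a) * (D.ofR a * (D.homog β b hb * h)) := by
            rw [homog_mul_ofR, mul_assoc, ofR_mul_ofR_comm]⟩)
    (fun {g x} ⟨h, hh⟩ => ⟨h * x, by rw [← mul_assoc, hh, mul_assoc]⟩)

theorem mem_denominatorIdeal [IsDomain R] {D : BRDatum 𝕜 R n} {f : D.algebra} {a : R} {ha : a ≠ 0}
    {hf : ∀ β b hb, D.ofR a * (D.homog β b hb * f) =
      D.ofR (D.sigmaPow β a) * (f * D.homog β b hb)} {g : D.algebra} :
    g ∈ D.denominatorIdeal f a ha hf ↔ ∃ h, f * g = D.ofR a * h :=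
  TwoSidedIdeal.mem_mk' _ _ _ _ _ _ _

/-- One homogeneous element has all its multiples by nonzero elements of `R` in `oreSet`; its degree
is `(1, …, 1)`, which is nonzero because `0 < n`. -/
theorem exists_homog_mul_ofR_mem_oreSet [IsDomain R] (hn : 0 < n) (D : BRDatum 𝕜 R n) :
    ∃ β b hb, ∀ a : R, a ≠ 0 → D.homog β b hb * D.ofR a ∈ D.oreSet := by
  obtain ⟨b, hb, hb0⟩ := D.exists_mem_I_ne_zero 1
  refine ⟨1, b, hb, fun a ha => ?_⟩
  have hm : ((D.homog 1 b hb * D.ofR a : D.algebra) : D.SkewLaurent) =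
      monomial _ 1 (b * D.sigmaPow 1 a) := by
    rw [Subalgebra.coe_mul, coe_homog, coe_ofR]
    simp [C, monomial_mul_monomial, cocycle_zero_right]
  refine ⟨Or.inl ⟨1, fun _ => zero_le_one, fun h => ?_, _, Ideal.mul_mem_right _ _ hb, hm⟩,
    fun h => ?_⟩
  · exact one_ne_zero (congrFun h ⟨0, hn⟩)
  · have h := congrArg (fun x : D.algebra => (x : D.SkewLaurent).coeff 1) h
    simp [hm, coeff_monomial, coeff_zero, hb0, ha] at h

/-- Among the shortest nonzero elements of a two-sided ideal there is one with nonzero constant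
coefficient, since multiplication by a homogeneous element shifts the support. -/
theorem exists_minimal_support [IsDomain R] (D : BRDatum 𝕜 R n) {K : TwoSidedIdeal D.algebra}
    (hK : K ≠ ⊥) : ∃ f ∈ K, (f : D.SkewLaurent).coeff 0 ≠ 0 ∧
      ∀ g ∈ K, g ≠ 0 → (support _ (f : D.SkewLaurent)).card ≤
        (support _ (g : D.SkewLaurent)).card := by
  classical
  have hne : {f : D.algebra | f ∈ K ∧ f ≠ 0}.Nonempty := by
    by_contra h
    refine hK (le_bot_iff.1 fun x hx => ?_)
    rw [TwoSidedIdeal.mem_bot]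
    by_contra hx0
    exact h ⟨x, hx, hx0⟩
  obtain ⟨f, ⟨hf, hf0⟩, hmin⟩ := WellFounded.has_min
    (measure fun f : D.algebra => (support _ (f : D.SkewLaurent)).card).wf _ hne
  obtain ⟨γ, hγ⟩ := exists_coeff_ne_zero (f := (f : D.SkewLaurent)) fun h => hf0 (Subtype.ext h)
  obtain ⟨c, hc, hc0⟩ := D.exists_mem_I_ne_zero (-γ)
  refine ⟨f * D.homog (-γ) c hc, K.mul_mem_right _ _ hf, ?_, fun g hg hg0 => ?_⟩
  · rw [Subalgebra.coe_mul, coe_homog, coeff_mul_monomial, ← Units.smul_def, Ne,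
      smul_eq_zero_iff_eq]
    simpa [hγ] using hc0
  · refine le_trans ?_ (not_lt.1 (hmin g ⟨hg, hg0⟩))
    refine (Finset.card_le_card (t := (support _ (f : D.SkewLaurent)).image (· + -γ))
      fun δ hδ => ?_).trans Finset.card_image_le
    rw [mem_support, Subalgebra.coe_mul, coe_homog, coeff_mul_monomial] at hδ
    refine Finset.mem_image.2 ⟨δ - -γ, mem_support.2 fun h => hδ ?_, by abel⟩
    rw [h, zero_mul, smul_zero]

/-- Over the fraction field of `R`, this says that `a⁻¹ f` is central, where `a` is the constant
coefficient of a shortest nonzero element `f` of `K`. -/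
theorem ofR_mul_homog_mul_of_minimal (D : BRDatum 𝕜 R n) {K : TwoSidedIdeal D.algebra}
    {f : D.algebra} (hf : f ∈ K) (ha : (f : D.SkewLaurent).coeff 0 ≠ 0)
    (hmin : ∀ g ∈ K, g ≠ 0 → (support _ (f : D.SkewLaurent)).card ≤
        (support _ (g : D.SkewLaurent)).card) (β : Fin n → ℤ) (b : R) (hb : b ∈ D.I β) :
    D.ofR ((f : D.SkewLaurent).coeff 0) * (D.homog β b hb * f) =
      D.ofR (D.sigmaPow β ((f : D.SkewLaurent).coeff 0)) * (f * D.homog β b hb) := by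
  classical
  set a := (f : D.SkewLaurent).coeff 0
  by_contra hne
  have hK : D.ofR a * (D.homog β b hb * f) -
      D.ofR (D.sigmaPow β a) * (f * D.homog β b hb) ∈ K :=
    K.sub_mem (K.mul_mem_left _ _ (K.mul_mem_left _ _ hf))
      (K.mul_mem_left _ _ (K.mul_mem_right _ _ hf))
  refine absurd (hmin _ hK (sub_ne_zero.2 hne)) (not_le.2 ?_)
  refine lt_of_le_of_lt ?_ (Finset.card_erase_lt_of_mem (mem_support.2 ha))
  refine (Finset.card_le_card (t := ((support _ (f : D.SkewLaurent)).erase 0).image (· + β))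
    fun δ hδ => ?_).trans Finset.card_image_le
  rw [mem_support, AddSubgroupClass.coe_sub, coeff_sub] at hδ
  simp only [Subalgebra.coe_mul, coe_ofR, coe_homog, coeff_C_mul, coeff_monomial_mul,
    coeff_mul_monomial] at hδ
  refine Finset.mem_image.2 ⟨δ - β, Finset.mem_erase.2 ⟨fun h => hδ ?_,
    mem_support.2 fun h => hδ (by simp [h])⟩, by abel⟩
  -- In degree `β` both products have the coefficient `a b σ ^ β (a)`.
  rw [h]
  simp only [cocycle_zero_left, cocycle_zero_right, sigmaPow_zero, Units.val_one, one_smul,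
    AlgEquiv.one_apply]
  change a * (b * D.sigmaPow β a) - D.sigmaPow β a * (a * b) = 0
  ring

theorem isSimpleRing_of_oreSet [IsDomain R] (hn : 0 < n) (D : BRDatum 𝕜 R n)
    (h1 : ∀ x ∈ D.oreSet, TwoSidedIdeal.span {x} = ⊤)
    (h3 : (Subalgebra.center 𝕜 D.algebra : Set D.algebra) ⊆ Set.range D.ofR) :
    IsSimpleRing D.algebra := by
  have htop : ∀ (K : TwoSidedIdeal D.algebra) (x), x ∈ D.oreSet → x ∈ K → K = ⊤ := fun K x hx hK =>
    top_le_iff.1 (h1 x hx ▸ TwoSidedIdeal.span_le.2 (Set.singleton_subset_iff.2 hK))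
  have hnt : Nontrivial D.algebra := by
    obtain ⟨β, b, hb, h⟩ := D.exists_homog_mul_ofR_mem_oreSet hn
    exact ⟨_, 0, (h 1 one_ne_zero).2⟩
  refine ⟨⟨fun K => or_iff_not_imp_left.2 fun hK => ?_⟩⟩
  obtain ⟨f, hf, ha, hmin⟩ := D.exists_minimal_support hK
  have hcomm := D.ofR_mul_homog_mul_of_minimal hf ha hmin
  obtain ⟨β, b, hb, hore⟩ := D.exists_homog_mul_ofR_mem_oreSet hn
  set a := (f : D.SkewLaurent).coeff 0 with hadef
  obtain ⟨h, hh⟩ : ∃ h, f = D.ofR a * h := by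
    -- Centrality of `a⁻¹ f` gives `a⁻¹ f (b t ^ β) a = (b t ^ β) f`, which has no denominator.
    have hL : D.homog β b hb * D.ofR a ∈ D.denominatorIdeal f a ha hcomm := by
      refine mem_denominatorIdeal.2 ⟨D.homog β b hb * f, ?_⟩
      rw [hcomm β b hb]
      have hb' : b * D.sigmaPow β a ∈ D.I β := Ideal.mul_mem_right _ _ hb
      have e : D.homog β b hb * D.ofR a = D.homog β _ hb' := Subtype.ext <| by
        rw [Subalgebra.coe_mul, coe_homog, coe_ofR, coe_homog]
        simp [C, monomial_mul_monomial, cocycle_zero_right]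
      refine D.ofR_mul_cancel (r := D.sigmaPow β a) (by simpa using ha) ?_
      rw [e, ← hcomm β _ hb', ← e, homog_mul_ofR, mul_assoc, ofR_mul_ofR_comm, hcomm β b hb]
    have h1L : (1 : D.algebra) ∈ D.denominatorIdeal f a ha hcomm :=
      htop _ _ (hore a ha) hL ▸ trivial
    simpa using mem_denominatorIdeal.1 h1L
  have hcen : h ∈ Subalgebra.center 𝕜 D.algebra := mem_center_of_commute_homog fun γ c hc => by
    refine D.ofR_mul_cancel ha (D.ofR_mul_cancel (r := D.sigmaPow γ a) (by simpa using ha) ?_)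
    have := hcomm γ c hc
    -- Substituting `f = a h` into `hcomm` and cancelling `a` and `σ ^ γ (a)` shows `h` is central.
    rw [hh, ← mul_assoc (D.homog γ c hc), homog_mul_ofR, mul_assoc, ofR_mul_ofR_comm,
      mul_assoc] at this
    exact this
  obtain ⟨r, hr⟩ := h3 hcen
  have hfa : f = D.ofR (a * r) := by rw [hh, ← hr, map_mul]
  have har : a * r ≠ 0 := by
    intro h0
    rw [h0, map_zero] at hfa
    exact ha (by rw [hadef, hfa]; rfl)
  exact htop K _ (hore _ har) (hfa ▸ K.mul_mem_left _ _ hf)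

end BRDatum

theorem mainTheorem2 {𝕜 R : Type*} [Field 𝕜] [CommRing R] [IsDomain R] [IsNoetherianRing R]
    [Algebra 𝕜 R] {n : ℕ} (_hn : 0 < n) (D : BRDatum 𝕜 R n) :
    IsSimpleRing D.algebra ↔
      (∀ x ∈ D.oreSet, TwoSidedIdeal.span {x} = ⊤) ∧
      D.IsGammaSimple ∧
      ((Subalgebra.center 𝕜 D.algebra : Set D.algebra) ⊆ Set.range D.ofR) := by
  refine ⟨fun h => ⟨fun x hx => ?_, D.isGammaSimple_of_isSimpleRing,
    D.center_subset_of_isSimpleRing⟩, fun h => D.isSimpleRing_of_oreSet _hn h.1 h.2.2⟩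
  refine (eq_bot_or_eq_top _).resolve_left fun e => hx.2 ?_
  have : x ∈ TwoSidedIdeal.span {x} := TwoSidedIdeal.subset_span rfl
  rwa [e, TwoSidedIdeal.mem_bot] at this
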